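/- Let $\mathbb{F}_q$ be a finite field with $q\ge 5$ elements $\alpha_1,\dots,\alpha_q$. For $1\le k\le q+1$ let $PRS(k)\subset\mathbb{F}_q^{q+1}$ be the projective Reed--Solomon code $\{(f(\alpha_1),\dots,f(\alpha_q),f(\infty)) : f\in\mathbb{F}_q[X],\ \deg f\le k-1\}$, where $f(\infty)$ denotes the coefficient of $X^{k-1}$ in $f$. The error distance of a word $u$ to a linear code $C\subset\mathbb{F}_q^n$ is the minimum Hamming distance from $u$ to a codeword, the covering radius $\rho(C)$ is the maximum error distance over all words, and a deep hole of $C$ is a word whose error distance equals $\rho(C)$. A deep hole class of $C$ is the class in $\mathbb{P}(\mathbb{F}_q^n/C)$ of a deep hole that is not a codeword; thus non-codewords $u,v$ have the same class if and only if $v=su+c$ for some $s\in\mathbb{F}_q^\times$ and $c\in C$. Theorem. The code $PRS(q-3)$ has exactly $q(q+1)^2/2$ deep hole classes. They are exactly the classes of the following words, all of which are deep holes and not codewords: (1) the words $(\alpha_1^{q-3},\dots,\alpha_q^{q-3},a)$ with $a\in\mathbb{F}_q$; (2) for $1\le i\le q$ and $a\in\mathbb{F}_q$, the word with $j$-th coordinate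 $\frac{1}{\alpha_j-\alpha_i}$ for $1\le j\le q$, $j\ne i$, with $i$-th coordinate $a$ and with last coordinate $0$; (3) the words $(g(\alpha_1),\dots,g(\alpha_q),0)$, where $g=a(X)/b(X)$ with $b(X)\in\mathbb{F}_q[X]$ monic irreducible of degree $2$ and $a(X)\in\mathbb{F}_q[X]$ monic of degree at most $1$. Distinct words among these represent distinct classes; the families (1), (2), (3) represent $q$, $q^2$ and $(q+1)q(q-1)/2$ classes respectively, and these three sets of classes are pairwise disjoint. -/

import Mathlib

open Polynomial

namespace PRSDeepHole

noncomputable section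

/-! ### Linear codes: error distance, covering radius, deep holes, deep hole classes -/

section LinearCode

open scoped LinearAlgebra.Projectivization

variable {F ι : Type*} [Field F] [DecidableEq F] [Fintype ι]

/-- The error distance `d(u, C)`: the least Hamming distance from `u` to a codeword of `C`. -/
def errorDist (C : Submodule F (ι → F)) (u : ι → F) : ℕ :=
  sInf {d : ℕ | ∃ v ∈ C, hammingDist u v = d}

/-- The covering radius `ρ(C)`: the largest error distance of a word
(a supremum of naturals bounded by the length of the code, hence a maximum). -/
def coveringRadius (C : Submodule F (ι → F)) : ℕ :=
  sSup (Set.range (errorDist C))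

/-- A deep hole of `C` is a word whose error distance is the covering radius. -/
def IsDeepHole (C : Submodule F (ι → F)) (u : ι → F) : Prop :=
  errorDist C u = coveringRadius C

/-- The classes, in the projective space `ℙ(F^ι / C)`, of the non-codewords in a set `S` of words.
Two non-codewords `u`, `v` have the same class iff `v = a u + c` with `a ≠ 0` and `c ∈ C`. -/
def classesOf (C : Submodule F (ι → F)) (S : Set (ι → F)) : Set (ℙ F ((ι → F) ⧸ C)) :=
  {P | ∃ u ∈ S, ∃ h : C.mkQ u ≠ 0, P = Projectivization.mk F (C.mkQ u) h}

/-- The deep hole classes of `C`. -/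
def deepHoleClasses (C : Submodule F (ι → F)) : Set (ℙ F ((ι → F) ⧸ C)) :=
  classesOf C {u | IsDeepHole C u}

end LinearCode

/-! ### Projective Reed-Solomon codes

Words of length `q + 1` are indexed by the evaluation set `F ∪ {∞}`, i.e. `OnePoint F`. -/

section PRS

variable {F : Type*} [Field F]

/-- Evaluation of `f` at the points of `F ∪ {∞}`, with `f(∞)` the coefficient of `X^(k-1)`. -/
def projEval (k : ℕ) : F[X] →ₗ[F] (OnePoint F → F) where
  toFun f := fun x => x.elim (f.coeff (k - 1)) fun α => f.eval α
  map_add' f g := by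
    funext x
    induction x using OnePoint.rec <;> simp
  map_smul' a f := by
    funext x
    induction x using OnePoint.rec <;> simp

variable (F) in
/-- The projective Reed-Solomon code `PRS(k)`: the evaluations on `F ∪ {∞}` of the polynomials
of degree at most `k - 1`. -/
def PRS (k : ℕ) : Submodule F (OnePoint F → F) :=
  (Polynomial.degreeLT F k).map (projEval k)

/-- The words `(α₁^k, …, α_q^k, a)` with `a ∈ F`. -/
def powerWords (F : Type*) [Field F] (k : ℕ) : Set (OnePoint F → F) :=
  {u | ∃ a : F, u = fun x => x.elim a fun α => α ^ k}

open Classical in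
/-- The words with entry `1/(α - β)` at `α ≠ β`, entry `a` at `β` and entry `0` at `∞`,
for `β, a ∈ F`. -/
def poleWords (F : Type*) [Field F] : Set (OnePoint F → F) :=
  {u | ∃ β a : F, u = fun x => x.elim 0 fun α => if α = β then a else 1 / (α - β)}

/-- The words `(g(α₁), …, g(α_q), 0)`, where `g = a(X)/b(X)` with `b` monic irreducible of
degree `2` and `a` monic (so nonzero) of degree at most `1`. -/
def quadWords (F : Type*) [Field F] : Set (OnePoint F → F) :=
  {u | ∃ a b : F[X], a.Monic ∧ a.natDegree ≤ 1 ∧ b.Monic ∧ Irreducible b ∧ b.natDegree = 2 ∧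
    u = fun x => x.elim 0 fun α => a.eval α / b.eval α}

end PRS

end

end PRSDeepHole

open PRSDeepHole

/-! ### Power sums over the finite field -/

section PowerSums

variable {F : Type*} [Field F] [Fintype F]

/-! The columns of a parity check matrix of `PRS (q - 3)` are the q + 1 points of the twisted cubic
in projective 3-space (`mem_PRS_iff`). Deep hole classes thus become points of that space, via the
syndrome, and the error distance is the least number of cubic points whose span contains the
syndrome.

Every point lies on a plane spanned by three cubic points (`exists_split_cubic`), so the covering
radius is at most 3, and the deep holes turn out to be the words whose syndrome lies on no secant. A
point off the cubic is apolar to exactly one binary quadratic form up to scalar, the kernel of its 2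
× 3 Hankel matrix. Two distinct rational roots put the point on a secant, a double root on a
tangent, no rational root on a line joining two conjugate points (`tangent_or_conjugate`);
conversely the last two cases exclude secants (`Apolar.eq_mul_cubicCoord`).

The three families realise these points: tangent at ∞, tangents at finite points, conjugate lines.
There are q + 1 tangents, each with q points off the cubic, and q(q-1)/2 conjugate lines with q + 1
points each, which add up to q(q+1)²/2. Uniqueness of the apolar form separates the lines
(`Apolar.eq_or_exists_root`). -/

theorem sum_pow_card_sub_one : ∑ x : F, x ^ (Fintype.card F - 1) = -1 := by
  classical
  have h1 : ∀ x : F, x ^ (Fintype.card F - 1) = 1 - if x = 0 then 1 else 0 := by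
    intro x
    have := Fintype.one_lt_card (α := F)
    split_ifs with h
    · subst h
      rw [zero_pow (by omega)]
      simp
    · rw [FiniteField.pow_card_sub_one_eq_one x h, sub_zero]
  simp only [h1, Finset.sum_sub_distrib]
  simp

/-- Above q - 1 the exponent is lowered by q - 1 using x^q = x; the bound stops before 2(q - 1),
where the sum is -1 again. -/
theorem sum_pow_eq_ite {i : ℕ} (hi : i < 2 * (Fintype.card F - 1)) :
    ∑ x : F, x ^ i = if i = Fintype.card F - 1 then -1 else 0 := by
  split_ifs with h
  · rw [h, sum_pow_card_sub_one]
  · rcases lt_or_gt_of_ne h with h | h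
    · exact FiniteField.sum_pow_lt_card_sub_one F i h
    · rw [← FiniteField.sum_pow_lt_card_sub_one F (i - (Fintype.card F - 1)) (by omega)]
      refine Finset.sum_congr rfl fun x _ => ?_
      obtain ⟨k, rfl⟩ : ∃ k, i = Fintype.card F + k := ⟨i - Fintype.card F, by omega⟩
      have := Fintype.one_lt_card (α := F)
      rw [pow_add, FiniteField.pow_card, ← pow_succ']
      congr 1
      omega

/-- Power sums read off coefficients: only the term of degree q - 1 in X^j f survives, and `hj`
keeps all degrees below 2(q - 1). -/
theorem sum_pow_mul_eval {f : F[X]} {j : ℕ} (hf : f.degree < Fintype.card F)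
    (hj : j + 1 < Fintype.card F) :
    ∑ x : F, x ^ j * f.eval x = -f.coeff (Fintype.card F - 1 - j) := by
  have hf' : f.natDegree < Fintype.card F := by
    by_cases h0 : f = 0
    · simpa [h0] using Fintype.card_pos
    · exact (natDegree_lt_iff_degree_lt h0).2 hf
  simp only [eval_eq_sum_range' hf', Finset.mul_sum]
  rw [Finset.sum_comm]
  have h : ∀ i ∈ Finset.range (Fintype.card F), ∑ x : F, x ^ j * (f.coeff i * x ^ i) =
      if i = Fintype.card F - 1 - j then -f.coeff i else 0 := by
    intro i hi
    have hi' := Finset.mem_range.1 hi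
    have : ∀ x : F, x ^ j * (f.coeff i * x ^ i) = f.coeff i * x ^ (i + j) := fun x => by ring
    simp only [this, ← Finset.mul_sum]
    rw [sum_pow_eq_ite (by omega)]
    split_ifs <;> first | omega | simp
  rw [Finset.sum_congr rfl h, Finset.sum_ite_eq', if_pos (Finset.mem_range.2 (by omega))]

theorem sum_inv_eq_zero (h : 2 < Fintype.card F) : ∑ x : F, x⁻¹ = 0 := by
  have h1 := FiniteField.sum_pow_lt_card_sub_one F 1 (by omega)
  simp only [pow_one] at h1
  rw [← h1]
  exact Fintype.sum_equiv (Equiv.inv F) _ _ fun _ => rfl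

end PowerSums

/-! ### The parity check matrix given by the twisted cubic -/

section Syndrome

variable {F : Type*} [Field F]

/-- The coordinates of the points of the twisted cubic, the columns of a parity check matrix of
`PRS (q - 3)`. -/
def cubicCoord (j : ℕ) (x : OnePoint F) : F := x.elim (if j = 3 then 1 else 0) fun t => t ^ j

@[simp] theorem cubicCoord_coe (j : ℕ) (t : F) : cubicCoord j (t : OnePoint F) = t ^ j := rfl

@[simp] theorem cubicCoord_infty (j : ℕ) :
    cubicCoord j (OnePoint.infty : OnePoint F) = if j = 3 then 1 else 0 := rfl

variable [Fintype F]

/-- The coordinates of the syndrome of a word. -/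
def syndrome (j : ℕ) : (OnePoint F → F) →ₗ[F] F :=
  ∑ x : OnePoint F, cubicCoord j x • LinearMap.proj x

theorem syndrome_apply (j : ℕ) (u : OnePoint F → F) :
    syndrome j u = ∑ x : OnePoint F, cubicCoord j x * u x := by
  simp [syndrome]

theorem syndrome_eq (j : ℕ) (u : OnePoint F → F) :
    syndrome j u = (if j = 3 then u OnePoint.infty else 0) + ∑ t : F, t ^ j * u t := by
  rw [syndrome_apply]
  refine (Fintype.sum_option (fun x : Option F => cubicCoord j (x : OnePoint F) * u x)).trans ?_
  congr 1
  change cubicCoord j OnePoint.infty * u OnePoint.infty = _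
  simp

theorem syndrome_single [DecidableEq (OnePoint F)] (j : ℕ) (x : OnePoint F) (c : F) :
    syndrome j (Pi.single x c) = c * cubicCoord j x := by
  rw [syndrome_apply, Finset.sum_eq_single x]
  · simp [mul_comm]
  · intro y _ hy
    simp [hy]
  · simp

/-- For the polynomial f of degree < q interpolating u, syndromes 0, 1, 2 are minus the coefficients
of degree q-1, q-2, q-3, and syndrome 3 compares the coefficient of degree q-4 with the entry at ∞.
-/
theorem mem_PRS_iff (hq : 5 ≤ Fintype.card F) (u : OnePoint F → F) :
    u ∈ PRS F (Fintype.card F - 3) ↔ ∀ j < 4, syndrome j u = 0 := by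
  classical
  constructor
  · rintro ⟨f, hf, rfl⟩ j hj
    have hf : f.degree < (Fintype.card F - 3 : ℕ) := mem_degreeLT.1 hf
    have hc : ∀ i, Fintype.card F - 3 ≤ i → f.coeff i = 0 := fun i hi =>
      coeff_eq_zero_of_degree_lt (hf.trans_le (by exact_mod_cast hi))
    rw [syndrome_eq]
    have h1 : ∑ t : F, t ^ j * (projEval (Fintype.card F - 3) f) t = _ :=
      sum_pow_mul_eval (hf.trans_le (by exact_mod_cast Nat.sub_le _ _)) (by omega)
    have h2 : (projEval (Fintype.card F - 3) f) OnePoint.infty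
      = f.coeff (Fintype.card F - 3 - 1) := rfl
    rw [h1, h2]
    split_ifs with h3
    · subst h3
      rw [show Fintype.card F - 3 - 1 = Fintype.card F - 1 - 3 by omega, add_neg_cancel]
    · rw [hc _ (by omega)]
      simp
  · intro h
    set f : F[X] := Lagrange.interpolate Finset.univ id fun t : F => u t with hf
    have hinj : Set.InjOn (id : F → F) (Finset.univ : Finset F) := Function.injective_id.injOn
    have hdeg : f.degree < Fintype.card F := Lagrange.degree_interpolate_lt _ hinj
    have hev : ∀ t : F, f.eval t = u t := fun t =>
      Lagrange.eval_interpolate_at_node (v := id) _ hinj (Finset.mem_univ t)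
    have hs : ∀ j < 4, (if j = 3 then u OnePoint.infty else 0)
        = f.coeff (Fintype.card F - 1 - j) := by
      intro j hj
      have h1 := h j hj
      rw [syndrome_eq] at h1
      simp only [← hev] at h1
      rw [sum_pow_mul_eval hdeg (by omega)] at h1
      linear_combination h1
    refine ⟨f, mem_degreeLT.2 ((degree_lt_iff_coeff_zero _ _).2 fun m hm => ?_), ?_⟩
    · by_cases hm' : Fintype.card F ≤ m
      · exact coeff_eq_zero_of_degree_lt (hdeg.trans_le (by exact_mod_cast hm'))
      · have := hs (Fintype.card F - 1 - m) (by omega)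
        rw [if_neg (by omega), show Fintype.card F - 1 - (Fintype.card F - 1 - m) = m by omega]
          at this
        exact this.symm
    · funext x
      induction x using OnePoint.rec with
      | infty =>
        change f.coeff (Fintype.card F - 3 - 1) = _
        have := hs 3 (by omega)
        rw [if_pos rfl] at this
        rw [this, show Fintype.card F - 3 - 1 = Fintype.card F - 1 - 3 by omega]
      | coe t => exact hev t

end Syndrome

/-! ### Secants, planes and apolar forms of the twisted cubic -/

section CubicPoints

theorem exists_ne_ne_ne_ne {F : Type*} [Fintype F] (hq : 5 ≤ Fintype.card F) (a b c d : F) :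
    ∃ t : F, t ≠ a ∧ t ≠ b ∧ t ≠ c ∧ t ≠ d := by
  classical
  obtain ⟨t, -, ht⟩ := Finset.exists_mem_notMem_of_card_lt_card
    (s := ({a, b, c, d} : Finset F)) (t := Finset.univ)
    (lt_of_le_of_lt Finset.card_le_four (by rw [Finset.card_univ]; omega))
  simp only [Finset.mem_insert, Finset.mem_singleton, not_or] at ht
  exact ⟨t, ht⟩

variable {F : Type*} [Field F]

/-- The value at a point of the projective line of the binary quadratic form with coefficients
`b₀, b₁, b₂`. -/
def quadForm (b₀ b₁ b₂ : F) (x : OnePoint F) : F := x.elim b₂ fun t => b₀ + b₁ * t + b₂ * t ^ 2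

/-- The binary quadratic form with coefficients `b₀, b₁, b₂` is apolar to the point `s`. -/
def Apolar (b₀ b₁ b₂ : F) (s : ℕ → F) : Prop :=
  ∀ j < 2, b₀ * s j + b₁ * s (j + 1) + b₂ * s (j + 2) = 0

theorem Apolar.smul {b₀ b₁ b₂ : F} {s t : ℕ → F} (h : Apolar b₀ b₁ b₂ s) (c : F)
    (hst : ∀ j < 4, t j = c * s j) : Apolar b₀ b₁ b₂ t := by
  intro j hj
  rw [hst j (by omega), hst (j + 1) (by omega), hst (j + 2) (by omega)]
  linear_combination c * h j hj

/-- A form with at most one root apolar to a point of a secant makes it a point of the cubic. -/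
theorem Apolar.eq_mul_cubicCoord {b₀ b₁ b₂ : F} {s : ℕ → F} (h : Apolar b₀ b₁ b₂ s)
    {x y z : OnePoint F} (hxy : x ≠ y) {l m : F}
    (hs : ∀ j < 4, s j = l * cubicCoord j x + m * cubicCoord j y)
    (hz : ∀ w, quadForm b₀ b₁ b₂ w = 0 → w = z) : ∃ n, ∀ j < 4, s j = n * cubicCoord j z := by
  -- With Q the form, the two apolarity equations read l Q(x) (1, x) + m Q(y) (1, y) = 0, where (1,
  -- ∞) means (0, 1); these two vectors are independent.
  have key : l * quadForm b₀ b₁ b₂ x = 0 ∧ m * quadForm b₀ b₁ b₂ y = 0 := by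
    have e0 := h 0 (by omega)
    have e1 := h 1 (by omega)
    simp only [hs 0 (by omega), hs 1 (by omega), hs (0 + 2) (by omega),
      hs (1 + 2) (by omega)] at e0 e1
    induction x using OnePoint.rec with
    | infty =>
      induction y using OnePoint.rec with
      | infty => exact absurd rfl hxy
      | coe y =>
        simp at e0 e1
        simp only [quadForm, OnePoint.elim_infty, OnePoint.elim_some]
        constructor
        · linear_combination e1 - y * e0
        · linear_combination e0
    | coe x =>
      induction y using OnePoint.rec with
      | infty =>
        simp at e0 e1
        simp only [quadForm, OnePoint.elim_infty, OnePoint.elim_some]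
        constructor
        · linear_combination e0
        · linear_combination e1 - x * e0
      | coe y =>
        simp at e0 e1
        have hne : x - y ≠ 0 := fun h => hxy (by rw [sub_eq_zero.1 h])
        simp only [quadForm, OnePoint.elim_some]
        constructor
        · apply mul_left_cancel₀ hne
          linear_combination e1 - y * e0
        · apply mul_left_cancel₀ hne
          linear_combination x * e0 - e1
  rcases mul_eq_zero.1 key.1 with h1 | h1 <;> rcases mul_eq_zero.1 key.2 with h2 | h2
  · exact ⟨0, fun j hj => by rw [hs j hj, h1, h2]; ring⟩
  · exact ⟨m, fun j hj => by rw [hs j hj, h1, hz y h2]; ring⟩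
  · exact ⟨l, fun j hj => by rw [hs j hj, h2, hz x h1]; ring⟩
  · exact absurd ((hz x h1).trans (hz y h2).symm) hxy

/-- With leading coefficient 1, apolarity is a linear recurrence of order 2, so the first two
coordinates determine the others. -/
theorem Apolar.eq_zero {b₀ b₁ : F} {s : ℕ → F} (h : Apolar b₀ b₁ 1 s) (h0 : s 0 = 0)
    (h1 : s 1 = 0) : ∀ j < 4, s j = 0 := by
  have e0 := h 0 (by omega)
  have e1 := h 1 (by omega)
  simp only [zero_add, Nat.reduceAdd] at e0 e1
  have h2 : s 2 = 0 := by linear_combination e0 - b₀ * h0 - b₁ * h1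
  have h3 : s 3 = 0 := by linear_combination e1 - b₀ * h1 - b₁ * h2
  intro j hj
  interval_cases j <;> assumption

/-- Two monic quadratics apolar to the same nonzero point agree or have a common root. -/
theorem Apolar.eq_or_exists_root {b₀ b₁ c₀ c₁ : F} {s : ℕ → F} (hb : Apolar b₀ b₁ 1 s)
    (hc : Apolar c₀ c₁ 1 s) (hs : ∃ j < 4, s j ≠ 0) :
    (b₀ = c₀ ∧ b₁ = c₁) ∨ ∃ e, b₀ + b₁ * e + e ^ 2 = 0 ∧ c₀ + c₁ * e + e ^ 2 = 0 := by
  have hne : ¬ (s 0 = 0 ∧ s 1 = 0) := fun h => by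
    obtain ⟨j, hj, hj'⟩ := hs
    exact hj' (hb.eq_zero h.1 h.2 j hj)
  have e0 := hb 0 (by omega)
  have e1 := hb 1 (by omega)
  have f0 := hc 0 (by omega)
  have f1 := hc 1 (by omega)
  simp only [zero_add, Nat.reduceAdd] at e0 e1 f0 f1
  have d0 : (b₀ - c₀) * s 0 + (b₁ - c₁) * s 1 = 0 := by linear_combination e0 - f0
  have d1 : (b₀ - c₀) * s 1 + (b₁ - c₁) * s 2 = 0 := by linear_combination e1 - f1
  by_cases h1 : b₁ - c₁ = 0
  · by_cases h0 : b₀ - c₀ = 0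
    · exact Or.inl ⟨sub_eq_zero.1 h0, sub_eq_zero.1 h1⟩
    · rw [h1] at d0 d1
      refine absurd ⟨?_, ?_⟩ hne
      · apply mul_left_cancel₀ h0
        linear_combination d0
      · apply mul_left_cancel₀ h0
        linear_combination d1
  · right
    -- The root of the linear difference of the two quadratics. It makes s 0, s 1, s 2 geometric
    -- with ratio e, so each apolarity equation at j = 0 says that e is a root.
    obtain ⟨e, he⟩ : ∃ e, (b₁ - c₁) * e = -(b₀ - c₀) := ⟨-(b₀ - c₀) / (b₁ - c₁), by field_simp⟩
    have s1 : s 1 = e * s 0 := by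
      apply mul_left_cancel₀ h1
      linear_combination d0 - s 0 * he
    have s2 : s 2 = e * s 1 := by
      apply mul_left_cancel₀ h1
      linear_combination d1 - s 1 * he
    have s0 : s 0 ≠ 0 := fun h => hne ⟨h, by rw [s1, h, mul_zero]⟩
    refine ⟨e, mul_left_cancel₀ s0 ?_, mul_left_cancel₀ s0 ?_⟩
    · rw [s2, s1] at e0
      linear_combination e0
    · rw [s2, s1] at f0
      linear_combination f0

/-- The plane through t, t', ∞ has the coefficients of (X - t)(X - t') as its equation. Coordinates
0 and 1 fix l and m, and n corrects coordinate 3. -/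
theorem exists_mul_cubicCoord_add_of_infty {s : ℕ → F} {t t' : F} (h : t ≠ t')
    (hs : s 2 - (t + t') * s 1 + t * t' * s 0 = 0) :
    ∃ l m n : F, ∀ j < 4, s j = l * cubicCoord j (t : OnePoint F) +
      m * cubicCoord j (t' : OnePoint F) + n * cubicCoord j (OnePoint.infty : OnePoint F) := by
  have h1 : t - t' ≠ 0 := sub_ne_zero.2 h
  have hs2 : s 2 = (t + t') * s 1 - t * t' * s 0 := by linear_combination hs
  refine ⟨(s 1 - t' * s 0) / (t - t'), (t * s 0 - s 1) / (t - t'),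
    s 3 - (s 1 - t' * s 0) / (t - t') * t ^ 3 - (t * s 0 - s 1) / (t - t') * t' ^ 3, ?_⟩
  intro j hj
  interval_cases j <;> simp
  · field_simp
    ring
  · field_simp
    ring
  · rw [hs2]
    field_simp
    ring

/-- The plane through t, t', t'' has the coefficients of (X - t)(X - t')(X - t'') as its equation;
l, m, n come from pairing s with the Lagrange basis polynomials. -/
theorem exists_mul_cubicCoord_add {s : ℕ → F} {t t' t'' : F} (h : t ≠ t') (h' : t ≠ t'')
    (h'' : t' ≠ t'') (hs : s 3 - (t + t' + t'') * s 2 + (t * t' + t * t'' + t' * t'') * s 1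
      - t * t' * t'' * s 0 = 0) :
    ∃ l m n : F, ∀ j < 4, s j = l * cubicCoord j (t : OnePoint F) +
      m * cubicCoord j (t' : OnePoint F) + n * cubicCoord j (t'' : OnePoint F) := by
  have h1 : t - t' ≠ 0 := sub_ne_zero.2 h
  have h2 : t - t'' ≠ 0 := sub_ne_zero.2 h'
  have h3 : t' - t'' ≠ 0 := sub_ne_zero.2 h''
  have hs3 : s 3 = (t + t' + t'') * s 2 - (t * t' + t * t'' + t' * t'') * s 1
      + t * t' * t'' * s 0 := by linear_combination hs
  refine ⟨(s 2 - (t' + t'') * s 1 + t' * t'' * s 0) / ((t - t') * (t - t'')),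
    -(s 2 - (t + t'') * s 1 + t * t'' * s 0) / ((t - t') * (t' - t'')),
    (s 2 - (t + t') * s 1 + t * t' * s 0) / ((t - t'') * (t' - t'')), ?_⟩
  intro j hj
  interval_cases j <;> simp
  · field_simp
    ring
  · field_simp
    ring
  · field_simp
    ring
  · rw [hs3]
    field_simp
    ring

variable [Fintype F]

/-- Used to write k as a product x · (k / x) of two distinct factors. -/
theorem exists_ne_zero_sq_ne (hq : 5 ≤ Fintype.card F) (k : F) : ∃ t : F, t ≠ 0 ∧ t ^ 2 ≠ k := by
  by_cases h : ∃ r, r ^ 2 = k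
  · obtain ⟨r, rfl⟩ := h
    obtain ⟨t, h0, h1, h2, -⟩ := exists_ne_ne_ne_ne hq 0 r (-r) 0
    refine ⟨t, h0, fun h => ?_⟩
    rcases sq_eq_sq_iff_eq_or_eq_neg.1 h with h | h
    · exact h1 h
    · exact h2 h
  · exact ⟨1, one_ne_zero, fun h' => h ⟨1, h'⟩⟩

/-- Every point lies on a plane that meets the twisted cubic in three distinct points. -/
theorem exists_split_cubic (hq : 5 ≤ Fintype.card F) (s : ℕ → F) :
    (∃ t t' : F, t ≠ t' ∧ s 2 - (t + t') * s 1 + t * t' * s 0 = 0) ∨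
    ∃ t t' t'' : F, t ≠ t' ∧ t ≠ t'' ∧ t' ≠ t'' ∧
      s 3 - (t + t' + t'') * s 2 + (t * t' + t * t'' + t' * t'') * s 1 - t * t' * t'' * s 0 = 0 := by
  by_cases h0 : s 0 = 0
  · by_cases h1 : s 1 = 0
    · by_cases h2 : s 2 = 0
      · exact Or.inl ⟨0, 1, zero_ne_one, by rw [h0, h1, h2]; ring⟩
      · right
        -- The plane equation becomes t + t' + t'' = m. In characteristic 2, t' = t'' would force t
        -- = m, hence the choice t ≠ m.
        obtain ⟨m, hm⟩ : ∃ m, s 3 = m * s 2 := ⟨s 3 / s 2, by field_simp⟩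
        obtain ⟨t, ht, -⟩ := exists_ne_ne_ne_ne hq m m m m
        by_cases h2' : (2 : F) = 0
        · obtain ⟨t', a1, a2, -⟩ := exists_ne_ne_ne_ne hq t (m - 2 * t) 0 0
          refine ⟨t, t', m - t - t', a1.symm, fun h => a2 ?_, fun h => ht ?_, ?_⟩
          · linear_combination h
          · linear_combination h - h2' * t'
          · rw [h0, h1, hm]
            ring
        · obtain ⟨t', a1, a2, a3, -⟩ := exists_ne_ne_ne_ne hq t (m - 2 * t) ((m - t) / 2) 0
          refine ⟨t, t', m - t - t', a1.symm, fun h => a2 ?_, fun h => a3 ?_, ?_⟩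
          · linear_combination h
          · field_simp
            linear_combination h
          · rw [h0, h1, hm]
            ring
    · by_cases h2' : (2 : F) = 0
      · by_cases h2 : s 2 = 0
        -- In characteristic 2 a plane through ∞ would need t + t' = 0, that is t = t'. Three finite
        -- points are used instead, with second elementary symmetric function k.
        · right
          obtain ⟨k, hk⟩ : ∃ k, s 3 = -k * s 1 := ⟨-(s 3 / s 1), by field_simp⟩
          by_cases hk0 : k = 0
          · obtain ⟨x, x0, x1, -⟩ := exists_ne_ne_ne_ne hq 0 1 0 0
            have hx : 1 + x ≠ 0 := fun h => x1 (by linear_combination h - h2')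
            refine ⟨1, x, x / (1 + x), x1.symm, fun h => ?_, fun h => ?_, ?_⟩
            · rw [eq_div_iff hx] at h
              exact one_ne_zero (α := F) (by linear_combination h)
            · rw [eq_div_iff hx] at h
              exact x0 (pow_eq_zero_iff two_ne_zero |>.1 (by linear_combination h))
            · rw [h0, h2, hk, hk0]
              field_simp
              linear_combination x * (1 + x) * s 1 * h2'
          · obtain ⟨x, x0, hx⟩ := exists_ne_zero_sq_ne hq k
            refine ⟨0, x, k / x, x0.symm, (div_ne_zero hk0 x0).symm, fun h => ?_, ?_⟩
            · rw [eq_div_iff x0] at h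
              exact hx (by linear_combination h)
            · rw [h0, h2, hk]
              field_simp
              ring
        · refine Or.inl ⟨0, s 2 / s 1, (div_ne_zero h2 h1).symm, ?_⟩
          field_simp
          ring
      · refine Or.inl ⟨s 2 / s 1 / 2 + 1, s 2 / s 1 / 2 - 1, fun h => h2' ?_, ?_⟩
        · linear_combination h
        · rw [h0]
          field_simp
          ring
  · left
    -- After division by s 0 the condition is (t - e)(t' - e) = e² - f.
    obtain ⟨e, he⟩ : ∃ e, s 1 = e * s 0 := ⟨s 1 / s 0, by field_simp⟩
    obtain ⟨f, hf⟩ : ∃ f, s 2 = f * s 0 := ⟨s 2 / s 0, by field_simp⟩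
    by_cases hk : e ^ 2 - f = 0
    · refine ⟨e, e + 1, by simp, ?_⟩
      rw [he, hf]
      linear_combination -s 0 * hk
    · obtain ⟨x, x0, hx⟩ := exists_ne_zero_sq_ne hq (e ^ 2 - f)
      refine ⟨e + x, e + (e ^ 2 - f) / x, fun h => ?_, ?_⟩
      · have h := add_left_cancel h
        rw [eq_div_iff x0] at h
        exact hx (by linear_combination h)
      · rw [he, hf]
        field_simp
        ring

end CubicPoints

/-! ### Error distance read from the syndrome -/

section Distance

theorem hammingNorm_sub_eq {K ι : Type*} [Field K] [DecidableEq K] [Fintype ι] (u v : ι → K) :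
    hammingNorm (u - v) = hammingDist u v := by
  simp [hammingNorm, hammingDist, sub_ne_zero]

theorem errorDist_le_iff {K ι : Type*} [Field K] [DecidableEq K] [Fintype ι]
    (C : Submodule K (ι → K)) (u : ι → K) (n : ℕ) :
    errorDist C u ≤ n ↔ ∃ w, hammingNorm w ≤ n ∧ u - w ∈ C := by
  constructor
  · intro h
    obtain ⟨v, hv, hd⟩ := Nat.sInf_mem (s := {d : ℕ | ∃ v ∈ C, hammingDist u v = d})
      ⟨_, 0, C.zero_mem, rfl⟩
    refine ⟨u - v, ?_, by simpa using hv⟩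
    rw [hammingNorm_sub_eq, hd]
    exact h
  · rintro ⟨w, hw, hC⟩
    have h : errorDist C u ≤ hammingDist u (u - w) := Nat.sInf_le ⟨u - w, hC, rfl⟩
    rw [← hammingNorm_sub_eq, sub_sub_cancel] at h
    exact h.trans hw

variable {F : Type*} [Field F] [Fintype F]

theorem sub_mem_PRS_iff (hq : 5 ≤ Fintype.card F) (u v : OnePoint F → F) :
    u - v ∈ PRS F (Fintype.card F - 3) ↔ ∀ j < 4, syndrome j u = syndrome j v := by
  simp only [mem_PRS_iff hq, map_sub, sub_eq_zero]

variable [DecidableEq F]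

theorem errorDist_le_two_iff (hq : 5 ≤ Fintype.card F) (u : OnePoint F → F) :
    errorDist (PRS F (Fintype.card F - 3)) u ≤ 2 ↔ ∃ x y : OnePoint F, x ≠ y ∧ ∃ l m : F,
      ∀ j < 4, syndrome j u = l * cubicCoord j x + m * cubicCoord j y := by
  classical
  rw [errorDist_le_iff]
  constructor
  · rintro ⟨w, hw, hC⟩
    rw [sub_mem_PRS_iff hq] at hC
    have hcard : 2 ≤ Fintype.card (OnePoint F) := by
      have : Fintype.card (OnePoint F) = Fintype.card F + 1 := Fintype.card_option
      omega
    -- The support is enlarged to exactly two positions, which also covers errors of weight 0 and 1.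
    obtain ⟨T, hT, hT2⟩ := Finset.exists_superset_card_eq hw hcard
    obtain ⟨x, y, hxy, rfl⟩ := Finset.card_eq_two.1 hT2
    refine ⟨x, y, hxy, w x, w y, fun j hj => ?_⟩
    rw [hC j hj, syndrome_apply, ← Finset.sum_subset (Finset.subset_univ {x, y}),
      Finset.sum_pair hxy]
    · ring
    · intro z _ hz
      have : w z = 0 := by
        by_contra h
        exact hz (hT (by simpa using h))
      rw [this, mul_zero]
  · rintro ⟨x, y, -, l, m, h⟩
    refine ⟨Pi.single x l + Pi.single y m, ?_, ?_⟩
    · refine (Finset.card_le_card (t := {x, y}) fun z hz => ?_).trans Finset.card_le_two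
      by_contra hz'
      simp only [Finset.mem_insert, Finset.mem_singleton, not_or] at hz'
      simp [hz'.1, hz'.2] at hz
    · rw [sub_mem_PRS_iff hq]
      intro j hj
      rw [h j hj, map_add, syndrome_single, syndrome_single]

theorem errorDist_le_three (hq : 5 ≤ Fintype.card F) (u : OnePoint F → F) :
    errorDist (PRS F (Fintype.card F - 3)) u ≤ 3 := by
  classical
  rw [errorDist_le_iff]
  obtain ⟨x, y, z, l, m, n, h⟩ : ∃ (x y z : OnePoint F) (l m n : F), ∀ j < 4, syndrome j u =
      l * cubicCoord j x + m * cubicCoord j y + n * cubicCoord j z := by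
    rcases exists_split_cubic hq (fun j => syndrome j u) with ⟨t, t', h, hs⟩ |
      ⟨t, t', t'', h, h', h'', hs⟩
    · exact ⟨_, _, _, exists_mul_cubicCoord_add_of_infty h hs⟩
    · exact ⟨_, _, _, exists_mul_cubicCoord_add h h' h'' hs⟩
  refine ⟨Pi.single x l + Pi.single y m + Pi.single z n, ?_, ?_⟩
  · refine (Finset.card_le_card (t := {x, y, z}) fun w hw => ?_).trans Finset.card_le_three
    by_contra hw'
    simp only [Finset.mem_insert, Finset.mem_singleton, not_or] at hw'
    simp [hw'.1, hw'.2.1, hw'.2.2] at hw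
  · rw [sub_mem_PRS_iff hq]
    intro j hj
    rw [h j hj, map_add, map_add, syndrome_single, syndrome_single, syndrome_single]

end Distance

/-! ### Syndromes of the three families -/

section Families

variable {F : Type*} [Field F]

/-- The word `(g(α₁), …, g(α_q), 0)` with `g = a / b`. -/
def fracWord (a b : F[X]) : OnePoint F → F := fun x => x.elim 0 fun t => a.eval t / b.eval t

/-- The word `(α₁^k, …, α_q^k, a)`. -/
def powerWord (k : ℕ) (a : F) : OnePoint F → F := fun x => x.elim a fun t => t ^ k

open Classical in
/-- The word with entry `1/(t - β)` at `t ≠ β`, entry `a` at `β` and entry `0` at `∞`. -/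
noncomputable def poleWord (β a : F) : OnePoint F → F :=
  fun x => x.elim 0 fun t => if t = β then a else 1 / (t - β)

theorem mem_powerWords {k : ℕ} {u : OnePoint F → F} :
    u ∈ powerWords F k ↔ ∃ a, u = powerWord k a := Iff.rfl

theorem mem_poleWords {u : OnePoint F → F} :
    u ∈ poleWords F ↔ ∃ β a, u = poleWord β a := Iff.rfl

theorem mem_quadWords {u : OnePoint F → F} :
    u ∈ quadWords F ↔ ∃ a b : F[X], a.Monic ∧ a.natDegree ≤ 1 ∧ b.Monic ∧ Irreducible b ∧
      b.natDegree = 2 ∧ u = fracWord a b := Iff.rfl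

theorem fracWord_zero (b : F[X]) : fracWord 0 b = 0 := by
  funext x
  induction x using OnePoint.rec <;> simp [fracWord]

theorem fracWord_smul (a b : F[X]) (c : F) : fracWord (c • a) b = c • fracWord a b := by
  funext x
  induction x using OnePoint.rec with
  | infty => simp [fracWord]
  | coe t =>
    simp [fracWord]
    ring

theorem fracWord_sub_smul (a a' b : F[X]) (c : F) :
    fracWord a b - c • fracWord a' b = fracWord (a - c • a') b := by
  funext x
  induction x using OnePoint.rec with
  | infty => simp [fracWord]
  | coe t =>
    simp [fracWord]
    ring

theorem eval_eq_of_monic {b : F[X]} (hb : b.Monic) (hd : b.natDegree = 2) (t : F) :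
    b.eval t = b.coeff 0 + b.coeff 1 * t + t ^ 2 := by
  have h2 : b.coeff 2 = 1 := hd ▸ hb.coeff_natDegree
  rw [eval_eq_sum_range, hd]
  simp [Finset.sum_range_succ, h2]

theorem eval_ne_zero_of_irreducible {b : F[X]} (hb : Irreducible b) (hd : b.natDegree = 2) (t : F) :
    b.eval t ≠ 0 := fun h => by
  have := degree_eq_one_of_irreducible_of_root hb h
  rw [degree_eq_natDegree hb.ne_zero, hd] at this
  norm_num at this

variable [Fintype F]

/-- The syndrome is (0, 0, -1, a), a point of the tangent at ∞. -/
theorem syndrome_powerWord (hq : 5 ≤ Fintype.card F) (a : F) {j : ℕ} (hj : j < 4) :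
    syndrome j (powerWord (Fintype.card F - 3) a) =
      (if j = 3 then a else 0) - if j = 2 then 1 else 0 := by
  rw [syndrome_eq]
  have h := sum_pow_mul_eval (F := F) (f := X ^ (Fintype.card F - 3)) (j := j)
    (by rw [degree_X_pow]; exact_mod_cast (by omega)) (by omega)
  simp only [eval_X_pow, coeff_X_pow] at h
  simp only [powerWord, OnePoint.elim_infty, OnePoint.elim_some]
  rw [h, sub_eq_add_neg]
  congr 2
  by_cases h2 : j = 2
  · rw [if_pos h2, if_pos (by omega)]
  · rw [if_neg h2, if_neg (by omega)]

open Classical in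
-- With P(β) = (1, β, β², β³), the syndrome is a P(β) - P'(β), on the tangent at β.
theorem syndrome_poleWord (hq : 5 ≤ Fintype.card F) (β a : F) {j : ℕ} (hj : j < 4) :
    syndrome j (poleWord β a) =
      β ^ j * a - j * β ^ (j - 1) := by
  -- Induction on t^(j+1)/(t-β) = β t^j/(t-β) + t^j for t ≠ β. At t = β the inverse is 0 by
  -- convention, whence the correction term β^j.
  have hrec : ∀ j, j + 1 < Fintype.card F →
      ∑ t : F, t ^ j * (t - β)⁻¹ = -(j * β ^ (j - 1)) := by
    intro j
    induction j with
    | zero =>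
      intro _
      simp only [pow_zero, one_mul, Nat.cast_zero, zero_mul, neg_zero]
      rw [← sum_inv_eq_zero (F := F) (by omega)]
      exact Fintype.sum_equiv (Equiv.subRight β) _ _ fun _ => rfl
    | succ j ih =>
      intro hj
      have h1 : ∀ t : F, t ^ (j + 1) * (t - β)⁻¹ =
          β * (t ^ j * (t - β)⁻¹) + (t ^ j - if t = β then β ^ j else 0) := by
        intro t
        split_ifs with h
        · subst h
          simp
        · have := sub_ne_zero.2 h
          field_simp
          ring
      simp only [h1, Finset.sum_add_distrib, ← Finset.mul_sum, Finset.sum_sub_distrib]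
      rw [ih (by omega), FiniteField.sum_pow_lt_card_sub_one F j (by omega)]
      simp only [Finset.sum_ite_eq', Finset.mem_univ, if_true, Nat.add_sub_cancel]
      rcases j with _ | j
      · simp
      · push_cast [Nat.add_sub_cancel]
        ring
  rw [syndrome_eq]
  simp only [poleWord, OnePoint.elim_infty, OnePoint.elim_some, ite_self, zero_add]
  have h1 : ∀ t : F, t ^ j * (if t = β then a else 1 / (t - β)) =
      (if t = β then β ^ j * a else 0) + t ^ j * (t - β)⁻¹ := by
    intro t
    split_ifs with h
    · subst h
      simp
    · rw [one_div, zero_add]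
  simp only [h1, Finset.sum_add_distrib]
  rw [hrec j (by omega)]
  simp [sub_eq_add_neg]

/-- Pairing with b clears the denominator and leaves the power sums ∑ t^j a(t) with j < 2, which
vanish because a has degree at most 1. -/
theorem apolar_fracWord (hq : 5 ≤ Fintype.card F) {a b : F[X]} (ha : a.natDegree ≤ 1)
    (hb : b.Monic) (hbi : Irreducible b) (hd : b.natDegree = 2) :
    Apolar (b.coeff 0) (b.coeff 1) 1 fun j => syndrome j (fracWord a b) := by
  intro j hj
  have h1 : ∀ j, syndrome j (fracWord a b) = ∑ t : F, t ^ j * (a.eval t / b.eval t) := by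
    intro j
    rw [syndrome_eq]
    simp [fracWord]
  simp only [h1, Finset.mul_sum, ← Finset.sum_add_distrib]
  have h2 := sum_pow_mul_eval (F := F) (f := a) (j := j)
    (lt_of_le_of_lt degree_le_natDegree (by exact_mod_cast (by omega))) (by omega)
  rw [coeff_eq_zero_of_natDegree_lt (by omega), neg_zero] at h2
  rw [← h2]
  refine Finset.sum_congr rfl fun t _ => ?_
  have hne := eval_ne_zero_of_irreducible hbi hd t
  have := eval_eq_of_monic hb hd t
  field_simp
  linear_combination -a.eval t * t ^ j * this

/-- If f gives the codeword, then a and b f agree on the whole field and both have degree below q,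
so a = b f, impossible by degree unless both sides are 0. -/
theorem eq_zero_of_fracWord_mem (hq : 5 ≤ Fintype.card F) {a b : F[X]} (ha : a.natDegree ≤ 1)
    (hbi : Irreducible b) (hd : b.natDegree = 2)
    (h : fracWord a b ∈ PRS F (Fintype.card F - 3)) : a = 0 := by
  obtain ⟨f, hf, hfa⟩ := h
  have hf : f.degree < (Fintype.card F - 3 : ℕ) := mem_degreeLT.1 hf
  have hev : ∀ t : F, a.eval t = (b * f).eval t := fun t => by
    have h1 : f.eval t = a.eval t / b.eval t := congr_fun hfa (t : OnePoint F)
    rw [eval_mul, h1, mul_div_cancel₀ _ (eval_ne_zero_of_irreducible hbi hd t)]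
  have hbf : (b * f).degree < Fintype.card F := by
    by_cases h0 : f = 0
    · simp [h0]
    · rw [← natDegree_lt_iff_degree_lt h0] at hf
      rw [← natDegree_lt_iff_degree_lt (mul_ne_zero hbi.ne_zero h0),
        natDegree_mul hbi.ne_zero h0]
      omega
  have hab : a = b * f := eq_of_degrees_lt_of_eval_finset_eq Finset.univ
    (lt_of_le_of_lt degree_le_natDegree (by rw [Finset.card_univ]; exact_mod_cast (by omega)))
    (by rwa [Finset.card_univ]) fun t _ => hev t
  by_contra ha0
  have h0 : f ≠ 0 := fun h0 => ha0 (by rw [hab, h0, mul_zero])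
  rw [hab, natDegree_mul hbi.ne_zero h0] at ha
  omega

/-- For fixed b, sending a to the first two syndromes is an injective linear map between planes,
hence surjective; the recurrence fixes the other two coordinates. -/
theorem exists_fracWord (hq : 5 ≤ Fintype.card F) {b : F[X]} (hb : b.Monic) (hbi : Irreducible b)
    (hd : b.natDegree = 2) {s : ℕ → F} (hs : Apolar (b.coeff 0) (b.coeff 1) 1 s) :
    ∃ a : F[X], a.natDegree ≤ 1 ∧ ∀ j < 4, syndrome j (fracWord a b) = s j := by
  have hlin : ∀ x y : F, fracWord (C x + C y * X) b = x • fracWord 1 b + y • fracWord X b := by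
    intro x y
    funext z
    induction z using OnePoint.rec with
    | infty => simp [fracWord]
    | coe t =>
      simp [fracWord]
      ring
  have hdeg : ∀ x y : F, (C x + C y * X).natDegree ≤ 1 := fun x y => by
    rw [add_comm]
    exact natDegree_linear_le
  let L : F × F →ₗ[F] F × F :=
    { toFun := fun p => (syndrome 0 (fracWord (C p.1 + C p.2 * X) b),
        syndrome 1 (fracWord (C p.1 + C p.2 * X) b))
      map_add' := fun p r => by
        ext <;> simp only [hlin] <;> simp only [Prod.mk_add_mk, Prod.fst_add, Prod.snd_add,
          map_add, map_smul, smul_eq_mul] <;> ring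
      map_smul' := fun c p => by
        ext <;> simp only [hlin] <;> simp only [Prod.smul_fst, Prod.smul_snd, map_add, map_smul,
          smul_eq_mul, RingHom.id_apply] <;> ring }
  have hinj : Function.Injective L := by
    rw [injective_iff_map_eq_zero]
    intro p hp
    have h0 := (apolar_fracWord hq (hdeg p.1 p.2) hb hbi hd).eq_zero
      (congr_arg Prod.fst hp) (congr_arg Prod.snd hp)
    have h1 := eq_zero_of_fracWord_mem hq (hdeg p.1 p.2) hbi hd ((mem_PRS_iff hq _).2 h0)
    ext
    · simpa using congr_arg (fun f => f.coeff 0) h1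
    · simpa using congr_arg (fun f => f.coeff 1) h1
  obtain ⟨p, hp⟩ := (LinearMap.injective_iff_surjective.1 hinj) (s 0, s 1)
  have hp0 : syndrome 0 (fracWord (C p.1 + C p.2 * X) b) = s 0 := congr_arg Prod.fst hp
  have hp1 : syndrome 1 (fracWord (C p.1 + C p.2 * X) b) = s 1 := congr_arg Prod.snd hp
  refine ⟨_, hdeg p.1 p.2, ?_⟩
  have h3 : Apolar (b.coeff 0) (b.coeff 1) 1
      fun j => syndrome j (fracWord (C p.1 + C p.2 * X) b) - s j := by
    intro j hj
    linear_combination apolar_fracWord hq (hdeg p.1 p.2) hb hbi hd j hj - hs j hj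
  intro j hj
  exact sub_eq_zero.1 (h3.eq_zero (sub_eq_zero.2 hp0) (sub_eq_zero.2 hp1) j hj)

end Families

/-! ### Covering radius and classification of deep holes -/

section DeepHoles

variable {F : Type*} [Field F] [Fintype F]

theorem not_mem_of_mem_powerWords (hq : 5 ≤ Fintype.card F) {u : OnePoint F → F}
    (hu : u ∈ powerWords F (Fintype.card F - 3)) : u ∉ PRS F (Fintype.card F - 3) := by
  obtain ⟨a, rfl⟩ := mem_powerWords.1 hu
  intro h
  have := (mem_PRS_iff hq _).1 h 2 (by omega)
  rw [syndrome_powerWord hq a (by omega)] at this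
  simp at this

theorem not_mem_of_mem_poleWords (hq : 5 ≤ Fintype.card F) {u : OnePoint F → F}
    (hu : u ∈ poleWords F) : u ∉ PRS F (Fintype.card F - 3) := by
  obtain ⟨β, a, rfl⟩ := mem_poleWords.1 hu
  intro h
  have h0 := (mem_PRS_iff hq _).1 h 0 (by omega)
  have h1 := (mem_PRS_iff hq _).1 h 1 (by omega)
  rw [syndrome_poleWord hq β a (by omega)] at h0 h1
  simp at h0 h1
  simp [h0] at h1

theorem not_mem_of_mem_quadWords (hq : 5 ≤ Fintype.card F) {u : OnePoint F → F}
    (hu : u ∈ quadWords F) : u ∉ PRS F (Fintype.card F - 3) := by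
  obtain ⟨a, b, ha, ha1, hb, hbi, hd, rfl⟩ := mem_quadWords.1 hu
  exact fun h => ha.ne_zero (eq_zero_of_fracWord_mem hq ha1 hbi hd h)

theorem apolar_powerWord (hq : 5 ≤ Fintype.card F) (a : F) : Apolar 1 0 0 fun j =>
    syndrome j (powerWord (Fintype.card F - 3) a) := by
  intro j hj
  interval_cases j <;> simp [syndrome_powerWord hq]

theorem apolar_poleWord (hq : 5 ≤ Fintype.card F) (β a : F) : Apolar (β ^ 2) (-(2 * β)) 1 fun j =>
    syndrome j (poleWord β a) := by
  intro j hj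
  interval_cases j <;> simp [syndrome_poleWord hq] <;> ring

variable [DecidableEq F]

/-- The apolar form of each word has at most one rational zero, so a syndrome on a secant would be a
multiple of a single cubic point; the explicit syndromes forbid this. -/
theorem two_lt_errorDist (hq : 5 ≤ Fintype.card F) {u : OnePoint F → F}
    (hu : u ∈ powerWords F (Fintype.card F - 3) ∪ poleWords F ∪ quadWords F) :
    2 < errorDist (PRS F (Fintype.card F - 3)) u := by
  by_contra hle
  obtain ⟨x, y, hxy, l, m, hs⟩ := (errorDist_le_two_iff hq u).1 (not_lt.1 hle)
  rcases hu with (hu | hu) | hu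
  · obtain ⟨a, rfl⟩ := mem_powerWords.1 hu
    obtain ⟨n, hn⟩ := (apolar_powerWord hq a).eq_mul_cubicCoord hxy hs (z := OnePoint.infty)
      (fun w hw => by
        induction w using OnePoint.rec with
        | infty => rfl
        | coe t => simp [quadForm] at hw)
    have := hn 2 (by omega)
    simp [syndrome_powerWord hq] at this
  · obtain ⟨β, a, rfl⟩ := mem_poleWords.1 hu
    obtain ⟨n, hn⟩ := (apolar_poleWord hq β a).eq_mul_cubicCoord hxy hs (z := (β : OnePoint F))
      (fun w hw => by
        induction w using OnePoint.rec with
        | infty => simp [quadForm] at hw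
        | coe t =>
          simp only [quadForm, OnePoint.elim_some] at hw
          have : (t - β) ^ 2 = 0 := by linear_combination hw
          rw [sub_eq_zero.1 (pow_eq_zero_iff two_ne_zero |>.1 this)])
    have h0 := hn 0 (by omega)
    have h1 := hn 1 (by omega)
    simp [syndrome_poleWord hq] at h0 h1
    rw [← h0] at h1
    exact one_ne_zero (α := F) (by linear_combination -h1)
  · have hC := not_mem_of_mem_quadWords hq hu
    obtain ⟨a, b, ha, ha1, hb, hbi, hd, rfl⟩ := mem_quadWords.1 hu
    have hap := apolar_fracWord hq ha1 hb hbi hd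
    -- The form has no rational zero, so z is arbitrary; ∞ makes coordinates 0 and 1 vanish.
    obtain ⟨n, hn⟩ := hap.eq_mul_cubicCoord hxy hs (z := OnePoint.infty)
      (fun w hw => by
        induction w using OnePoint.rec with
        | infty => rfl
        | coe t =>
          simp only [quadForm, OnePoint.elim_some, one_mul] at hw
          exact absurd ((eval_eq_of_monic hb hd t).trans hw)
            (eval_ne_zero_of_irreducible hbi hd t))
    refine hC ((mem_PRS_iff hq _).2 (hap.eq_zero ?_ ?_))
    · exact (hn 0 (by omega)).trans (by simp)
    · exact (hn 1 (by omega)).trans (by simp)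

theorem coveringRadius_PRS (hq : 5 ≤ Fintype.card F) :
    coveringRadius (PRS F (Fintype.card F - 3)) = 3 := by
  have hbd : BddAbove (Set.range (errorDist (PRS F (Fintype.card F - 3)))) :=
    ⟨3, by rintro _ ⟨u, rfl⟩; exact errorDist_le_three hq u⟩
  apply le_antisymm
  · exact csSup_le' (by rintro _ ⟨u, rfl⟩; exact errorDist_le_three hq u)
  · refine le_trans ?_ (le_csSup hbd ⟨powerWord (Fintype.card F - 3) 0, rfl⟩)
    exact two_lt_errorDist hq (Or.inl (Or.inl (mem_powerWords.2 ⟨0, rfl⟩)))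

theorem isDeepHole_iff (hq : 5 ≤ Fintype.card F) (u : OnePoint F → F) :
    IsDeepHole (PRS F (Fintype.card F - 3)) u ↔
      2 < errorDist (PRS F (Fintype.card F - 3)) u := by
  rw [IsDeepHole, coveringRadius_PRS hq]
  have := errorDist_le_three hq u
  omega

omit [Fintype F] [DecidableEq F] in
/-- Every point off the secants of the twisted cubic lies on a tangent or on a line joining two
conjugate points. -/
theorem tangent_or_conjugate {s : ℕ → F}
    (hs : ¬ ∃ x y : OnePoint F, x ≠ y ∧ ∃ l m : F,
      ∀ j < 4, s j = l * cubicCoord j x + m * cubicCoord j y) :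
    (s 0 = 0 ∧ s 1 = 0 ∧ s 2 ≠ 0) ∨
    (∃ β, Apolar (β ^ 2) (-(2 * β)) 1 s ∧ s 1 - β * s 0 ≠ 0) ∨
    ∃ b₀ b₁, Apolar b₀ b₁ 1 s ∧ ∀ t, b₀ + b₁ * t + t ^ 2 ≠ 0 := by
  have hpt : ∀ (x : OnePoint F) (l : F), ¬ ∀ j < 4, s j = l * cubicCoord j x := by
    intro x l h
    obtain ⟨y, hy⟩ : ∃ y, x ≠ y := by
      induction x using OnePoint.rec with
      | infty => exact ⟨(0 : F), OnePoint.infty_ne_coe 0⟩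
      | coe t => exact ⟨OnePoint.infty, OnePoint.coe_ne_infty t⟩
    exact hs ⟨x, y, hy, l, 0, fun j hj => by rw [h j hj, zero_mul, add_zero]⟩
  have hinf : ∀ t : F, s 1 = t * s 0 → s 2 = t * s 1 → False := by
    intro t h1 h2
    refine hs ⟨t, OnePoint.infty, OnePoint.coe_ne_infty t, s 0, s 3 - s 0 * t ^ 3, fun j hj => ?_⟩
    interval_cases j <;> simp
    · linear_combination h1
    · linear_combination h2 + t * h1
  have hmonic : ∀ b₀ b₁, Apolar b₀ b₁ 1 s →
      (∃ β, Apolar (β ^ 2) (-(2 * β)) 1 s ∧ s 1 - β * s 0 ≠ 0) ∨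
      ∃ b₀ b₁, Apolar b₀ b₁ 1 s ∧ ∀ t, b₀ + b₁ * t + t ^ 2 ≠ 0 := by
    intro b₀ b₁ hb
    by_cases hr : ∃ t, b₀ + b₁ * t + t ^ 2 = 0
    · left
      obtain ⟨t, ht⟩ := hr
      have e0 := hb 0 (by omega)
      have e1 := hb 1 (by omega)
      simp only [zero_add, Nat.reduceAdd] at e0 e1
      -- The second root r. If r = t the point is on the tangent at t, otherwise on the secant
      -- through t and r.
      obtain ⟨r, hr⟩ : ∃ r, b₁ = -(t + r) := ⟨-b₁ - t, by ring⟩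
      have hb0 : b₀ = t * r := by
        rw [hr] at ht
        linear_combination ht
      by_cases htr : t = r
      · subst htr
        have hap : Apolar (t ^ 2) (-(2 * t)) 1 s := by
          rw [hr, hb0] at hb
          convert hb using 1 <;> ring
        refine ⟨t, hap, fun h => hinf t (sub_eq_zero.1 h) ?_⟩
        rw [hr, hb0] at e0
        linear_combination e0 + t * h
      · exfalso
        have hd : t - r ≠ 0 := sub_ne_zero.2 htr
        refine hs ⟨t, r, fun h => htr (OnePoint.coe_injective h), (s 1 - r * s 0) / (t - r),
          (t * s 0 - s 1) / (t - r), fun j hj => ?_⟩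
        have h2 : s 2 = (t + r) * s 1 - t * r * s 0 := by
          rw [hr, hb0] at e0
          linear_combination e0
        have h3 : s 3 = (t + r) * s 2 - t * r * s 1 := by
          rw [hr, hb0] at e1
          linear_combination e1
        rw [h2] at h3
        interval_cases j <;> simp
        · field_simp
          ring
        · field_simp
          ring
        · rw [h2]
          field_simp
          ring
        · rw [h3]
          field_simp
          ring
    · push Not at hr
      exact Or.inr ⟨b₀, b₁, hb, hr⟩
  by_cases d2 : s 0 * s 2 - s 1 ^ 2 = 0
  · by_cases h0 : s 0 = 0
    · left
      have h1 : s 1 = 0 := pow_eq_zero_iff two_ne_zero |>.1 (by rw [h0] at d2; linear_combination -d2)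
      refine ⟨h0, h1, fun h2 => hpt OnePoint.infty (s 3) fun j hj => ?_⟩
      interval_cases j <;> simp [h0, h1, h2]
    · exfalso
      refine hinf (s 1 / s 0) (by field_simp) ?_
      field_simp
      linear_combination d2
  · right
    -- The kernel of the Hankel matrix with rows (s 0, s 1, s 2) and (s 1, s 2, s 3) is spanned by
    -- its signed 2 × 2 minors, scaled here to leading coefficient 1.
    refine hmonic ((s 1 * s 3 - s 2 ^ 2) / (s 0 * s 2 - s 1 ^ 2))
      (-(s 0 * s 3 - s 1 * s 2) / (s 0 * s 2 - s 1 ^ 2)) ?_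
    intro j hj
    apply mul_left_cancel₀ d2
    rw [one_mul, mul_add, mul_add, ← mul_assoc, ← mul_assoc, mul_div_cancel₀ _ d2,
      mul_div_cancel₀ _ d2]
    interval_cases j <;> simp only [zero_add, Nat.reduceAdd] <;> ring

/-- Every deep hole is equivalent to a word of one of the three families. -/
theorem exists_family_word (hq : 5 ≤ Fintype.card F) {u : OnePoint F → F}
    (hu : 2 < errorDist (PRS F (Fintype.card F - 3)) u) :
    ∃ v ∈ powerWords F (Fintype.card F - 3) ∪ poleWords F ∪ quadWords F, ∃ c : F, c ≠ 0 ∧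
      v - c • u ∈ PRS F (Fintype.card F - 3) := by
  have hu' := not_le.2 hu
  rw [errorDist_le_two_iff hq] at hu'
  simp only [sub_mem_PRS_iff hq, map_smul, smul_eq_mul]
  rcases tangent_or_conjugate (s := fun j => syndrome j u) hu' with
    ⟨h0, h1, h2⟩ | ⟨β, hap, hne⟩ | ⟨b₀, b₁, hap, hr⟩
  · refine ⟨powerWord _ _, Or.inl (Or.inl ⟨-syndrome 3 u / syndrome 2 u, rfl⟩), -(syndrome 2 u)⁻¹,
      neg_ne_zero.2 (inv_ne_zero h2), fun j hj => ?_⟩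
    rw [syndrome_powerWord hq _ hj]
    interval_cases j
    · simp [h0]
    · simp [h1]
    · simp [h2]
    · simp
      ring
  · have e0 := hap 0 (by omega)
    have e1 := hap 1 (by omega)
    simp only [zero_add, Nat.reduceAdd] at e0 e1
    -- Syndromes 0 and 1 of the pole word are a and βa - 1, so c must satisfy c (syndrome 1 - β
    -- syndrome 0) = -1.
    refine ⟨poleWord _ _, Or.inl (Or.inr ⟨β, -(syndrome 1 u - β * syndrome 0 u)⁻¹ * syndrome 0 u, rfl⟩),
      -(syndrome 1 u - β * syndrome 0 u)⁻¹, neg_ne_zero.2 (inv_ne_zero hne), fun j hj => ?_⟩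
    rw [syndrome_poleWord hq _ _ hj]
    have h2 : syndrome 2 u = 2 * β * syndrome 1 u - β ^ 2 * syndrome 0 u := by linear_combination e0
    have h3 : syndrome 3 u = 2 * β * syndrome 2 u - β ^ 2 * syndrome 1 u := by linear_combination e1
    rw [h2] at h3
    interval_cases j
    · simp
    · simp
      field_simp
      ring
    · rw [h2]
      simp
      field_simp
      ring
    · rw [h3]
      simp
      field_simp
      ring
  · set b : F[X] := X ^ 2 + C b₁ * X + C b₀ with hb
    have hbm : b.Monic := by rw [hb]; monicity!
    have hd : b.natDegree = 2 := by rw [hb]; compute_degree!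
    have hc0 : b.coeff 0 = b₀ := by simp [hb]
    have hc1 : b.coeff 1 = b₁ := by simp [hb, coeff_C]
    have hbi : Irreducible b := by
      refine irreducible_of_degree_le_three_of_not_isRoot (by simp [hd]) fun t ht => hr t ?_
      have := eval_eq_of_monic hbm hd t
      rw [hc0, hc1] at this
      rw [← this]
      exact ht
    obtain ⟨a, ha, has⟩ := exists_fracWord hq hbm hbi hd (s := fun j => syndrome j u)
      (by rwa [hc0, hc1])
    have ha0 : a ≠ 0 := by
      rintro rfl
      -- If a = 0 the syndrome is 0, which lies on every secant.
      refine hu' ⟨OnePoint.infty, (0 : F), OnePoint.infty_ne_coe 0, 0, 0, fun j hj => ?_⟩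
      rw [← has j hj, fracWord_zero]
      simp
    have hl := leadingCoeff_ne_zero.2 ha0
    refine ⟨fracWord (a.leadingCoeff⁻¹ • a) b, Or.inr ⟨_, b, ?_, ?_, hbm, hbi, hd, rfl⟩,
      a.leadingCoeff⁻¹, inv_ne_zero hl, fun j hj => ?_⟩
    · rw [smul_eq_C_mul, Monic, leadingCoeff_mul, leadingCoeff_C, inv_mul_cancel₀ hl]
    · exact (natDegree_smul_le _ _).trans ha
    · rw [← has j hj, fracWord_smul, map_smul, smul_eq_mul]

end DeepHoles

/-! ### Classes in the projective space of the quotient -/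

section Classes

open scoped LinearAlgebra.Projectivization

variable {F ι : Type*} [Field F] {C : Submodule F (ι → F)} {S T : Set (ι → F)}

theorem mkQ_ne_zero_iff {u : ι → F} : C.mkQ u ≠ 0 ↔ u ∉ C := by
  rw [Submodule.mkQ_apply, Ne, Submodule.Quotient.mk_eq_zero]

theorem mk_eq_mk_iff_sub_smul_mem {u v : ι → F} (hu : C.mkQ u ≠ 0) (hv : C.mkQ v ≠ 0) :
    Projectivization.mk F (C.mkQ u) hu = Projectivization.mk F (C.mkQ v) hv ↔
      ∃ s : F, s ≠ 0 ∧ v - s • u ∈ C := by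
  rw [eq_comm, Projectivization.mk_eq_mk_iff']
  simp only [Submodule.mkQ_apply, ← Submodule.Quotient.mk_smul]
  constructor
  · rintro ⟨a, ha⟩
    refine ⟨a, ?_, (Submodule.Quotient.eq C).1 ha.symm⟩
    rintro rfl
    rw [zero_smul, Submodule.Quotient.mk_zero] at ha
    exact hv ha.symm
  · rintro ⟨a, -, ha⟩
    exact ⟨a, ((Submodule.Quotient.eq C).2 ha).symm⟩

theorem classesOf_union : classesOf C (S ∪ T) = classesOf C S ∪ classesOf C T := by
  ext P
  simp only [classesOf, Set.mem_union, Set.mem_ofPred_eq, or_and_right, exists_or]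

theorem classesOf_mono (h : S ⊆ T) : classesOf C S ⊆ classesOf C T := by
  rintro P ⟨u, hu, h'⟩
  exact ⟨u, h hu, h'⟩

theorem classesOf_subset (h : ∀ u ∈ S, u ∉ C → ∃ v ∈ T, ∃ s : F, s ≠ 0 ∧ v - s • u ∈ C) :
    classesOf C S ⊆ classesOf C T := by
  rintro P ⟨u, hu, hne, rfl⟩
  obtain ⟨v, hv, s, hs, hC⟩ := h u hu (mkQ_ne_zero_iff.1 hne)
  have hvC : C.mkQ v ≠ 0 := by
    rw [mkQ_ne_zero_iff] at hne ⊢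
    intro hvC
    have h1 : s • u ∈ C := by simpa using C.sub_mem hvC hC
    exact hne ((C.smul_mem_iff hs).1 h1)
  exact ⟨v, hv, hvC, (mk_eq_mk_iff_sub_smul_mem hne hvC).2 ⟨s, hs, hC⟩⟩

theorem ncard_classesOf (hS : ∀ u ∈ S, u ∉ C)
    (hinj : ∀ u ∈ S, ∀ v ∈ S, ∀ s : F, s ≠ 0 → v - s • u ∈ C → u = v) :
    (classesOf C S).ncard = S.ncard := by
  symm
  refine Set.ncard_congr
    (fun u hu => Projectivization.mk F (C.mkQ u) (mkQ_ne_zero_iff.2 (hS u hu))) ?_ ?_ ?_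
  · exact fun u hu => ⟨u, hu, _, rfl⟩
  · intro u v hu hv h
    obtain ⟨s, hs, hC⟩ := (mk_eq_mk_iff_sub_smul_mem _ _).1 h
    exact hinj u hu v hv s hs hC
  · rintro P ⟨u, hu, hne, rfl⟩
    exact ⟨u, hu, rfl⟩

theorem disjoint_classesOf (h : ∀ u ∈ S, ∀ v ∈ T, ∀ s : F, s ≠ 0 → v - s • u ∉ C) :
    Disjoint (classesOf C S) (classesOf C T) := by
  rw [Set.disjoint_left]
  rintro P ⟨u, hu, hne, rfl⟩ ⟨v, hv, hne', h'⟩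
  obtain ⟨s, hs, hC⟩ := (mk_eq_mk_iff_sub_smul_mem hne hne').1 h'
  exact h u hu v hv s hs hC

/-- Symmetry of the equivalence, so that each pair of families needs comparing in one order only. -/
theorem sub_inv_smul_mem {u v : ι → F} {s : F} (hs : s ≠ 0) (h : v - s • u ∈ C) :
    u - s⁻¹ • v ∈ C := by
  have := C.smul_mem (-s⁻¹) h
  rwa [smul_sub, neg_smul, neg_smul, smul_smul, inv_mul_cancel₀ hs, one_smul, sub_neg_eq_add,
    neg_add_eq_sub] at this

end Classes

/-! ### Counting monic and irreducible polynomials -/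

section Counting

variable (F : Type*) [Field F] [Fintype F]

theorem ncard_monic_natDegree_le_one :
    {a : F[X] | a.Monic ∧ a.natDegree ≤ 1}.ncard = Fintype.card F + 1 := by
  have h : {a : F[X] | a.Monic ∧ a.natDegree ≤ 1} =
      insert 1 (Set.range fun c : F => X + C c) := by
    ext a
    simp only [Set.mem_ofPred_eq, Set.mem_insert_iff, Set.mem_range]
    constructor
    · rintro ⟨ha, hd⟩
      rcases Nat.le_one_iff_eq_zero_or_eq_one.1 hd with hd | hd
      · exact Or.inl (ha.natDegree_eq_zero.1 hd)
      · exact Or.inr ⟨a.coeff 0, (ha.eq_X_add_C hd).symm⟩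
    · rintro (rfl | ⟨c, rfl⟩)
      · simp
      · exact ⟨monic_X_add_C c, (natDegree_X_add_C c).le⟩
  rw [h, Set.ncard_insert_of_notMem _ (Set.finite_range _), ← Set.image_univ,
    Set.ncard_image_of_injective, Set.ncard_univ, Nat.card_eq_fintype_card]
  · intro c d hcd
    exact C_injective (add_left_cancel hcd)
  · rintro ⟨c, hc⟩
    have := congr_arg natDegree hc
    simp at this

theorem ncard_monic_natDegree_two :
    {b : F[X] | b.Monic ∧ b.natDegree = 2}.ncard = Fintype.card F ^ 2 := by
  have h : {b : F[X] | b.Monic ∧ b.natDegree = 2} =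
      (fun p : F × F => X ^ 2 + C p.1 * X + C p.2) '' Set.univ := by
    ext b
    simp only [Set.mem_ofPred_eq, Set.image_univ, Set.mem_range]
    constructor
    · rintro ⟨hb, hd⟩
      refine ⟨(b.coeff 1, b.coeff 0), ?_⟩
      have h2 : b.coeff 2 = 1 := hd ▸ hb.coeff_natDegree
      conv_rhs => rw [b.as_sum_range_C_mul_X_pow, hd]
      simp [Finset.sum_range_succ, h2]
      ring
    · rintro ⟨p, rfl⟩
      exact ⟨by monicity!, by compute_degree!⟩
  rw [h, Set.ncard_image_of_injective, Set.ncard_univ, Nat.card_eq_fintype_card,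
    Fintype.card_prod, sq]
  intro p r h
  have h0 := congr_arg (fun f => f.coeff 0) h
  have h1 := congr_arg (fun f => f.coeff 1) h
  simp [coeff_C] at h0 h1
  exact Prod.ext h1 h0

/-- Split monic quadratics correspond to unordered pairs of roots, repetition allowed. -/
theorem ncard_split_quadratic :
    {b : F[X] | ∃ x y, b = (X - C x) * (X - C y)}.ncard =
      (Fintype.card F + 1).choose 2 := by
  classical
  let f : Sym2 F → F[X] := Sym2.lift ⟨fun x y => (X - C x) * (X - C y), fun x y => mul_comm _ _⟩
  have h : {b : F[X] | ∃ x y, b = (X - C x) * (X - C y)} = f '' Set.univ := by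
    ext b
    simp only [Set.mem_ofPred_eq, Set.image_univ, Set.mem_range]
    constructor
    · rintro ⟨x, y, rfl⟩
      exact ⟨s(x, y), rfl⟩
    · rintro ⟨p, rfl⟩
      induction p using Sym2.ind with
      | _ x y => exact ⟨x, y, rfl⟩
  rw [h, Set.ncard_image_of_injective, Set.ncard_univ, Nat.card_eq_fintype_card, Sym2.card]
  intro p r
  induction p using Sym2.ind with
  | _ x y =>
    induction r using Sym2.ind with
    | _ z w =>
      intro hpr
      replace hpr : (X - C x) * (X - C y) = (X - C z) * (X - C w) := hpr
      have hx := congr_arg (eval x) hpr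
      simp only [eval_mul, eval_sub, eval_X, eval_C, sub_self, zero_mul] at hx
      rw [Sym2.eq_iff]
      rcases mul_eq_zero.1 hx.symm with hx | hx
      · left
        rw [sub_eq_zero.1 hx] at hpr ⊢
        exact ⟨rfl, C_injective (sub_right_injective (mul_left_cancel₀ (X_sub_C_ne_zero z) hpr))⟩
      · right
        rw [sub_eq_zero.1 hx, mul_comm] at hpr
        rw [sub_eq_zero.1 hx]
        exact ⟨rfl, C_injective (sub_right_injective (mul_right_cancel₀ (X_sub_C_ne_zero w) hpr))⟩

/-- All q² monic quadratics minus the split ones. -/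
theorem ncard_irreducible_quadratic :
    ({b : F[X] | b.Monic ∧ Irreducible b ∧ b.natDegree = 2}.ncard : ℚ) =
      Fintype.card F * (Fintype.card F - 1) / 2 := by
  have hunion : {b : F[X] | b.Monic ∧ b.natDegree = 2} =
      {b : F[X] | b.Monic ∧ Irreducible b ∧ b.natDegree = 2} ∪
        {b : F[X] | ∃ x y, b = (X - C x) * (X - C y)} := by
    ext b
    simp only [Set.mem_ofPred_eq, Set.mem_union]
    constructor
    · rintro ⟨hb, hd⟩
      by_cases hbi : Irreducible b
      · exact Or.inl ⟨hb, hbi, hd⟩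
      · right
        obtain ⟨x, hx⟩ : ∃ x, b.IsRoot x := by
          by_contra! h
          exact hbi (irreducible_of_degree_le_three_of_not_isRoot (by simp [hd]) h)
        obtain ⟨c, hc⟩ := dvd_iff_isRoot.2 hx
        have hcm : c.Monic := (monic_X_sub_C x).of_mul_monic_left (hc ▸ hb)
        have hcd : c.natDegree = 1 := by
          rw [hc, (monic_X_sub_C x).natDegree_mul hcm, natDegree_X_sub_C] at hd
          omega
        refine ⟨x, -c.coeff 0, ?_⟩
        rw [hc, C_neg, sub_neg_eq_add, ← hcm.eq_X_add_C hcd]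
    · rintro (⟨hb, -, hd⟩ | ⟨x, y, rfl⟩)
      · exact ⟨hb, hd⟩
      · refine ⟨(monic_X_sub_C x).mul (monic_X_sub_C y), ?_⟩
        rw [(monic_X_sub_C x).natDegree_mul (monic_X_sub_C y), natDegree_X_sub_C,
          natDegree_X_sub_C]
  have hfin : {b : F[X] | b.Monic ∧ b.natDegree = 2}.Finite :=
    Set.finite_of_ncard_ne_zero (by
      rw [ncard_monic_natDegree_two]
      exact pow_ne_zero 2 Fintype.card_ne_zero)
  have hdisj : Disjoint {b : F[X] | b.Monic ∧ Irreducible b ∧ b.natDegree = 2}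
      {b : F[X] | ∃ x y, b = (X - C x) * (X - C y)} := by
    rw [Set.disjoint_left]
    rintro b ⟨-, hbi, hd⟩ ⟨x, y, rfl⟩
    exact eval_ne_zero_of_irreducible hbi hd x (by simp)
  have h := Set.ncard_union_eq hdisj (hfin.subset (hunion ▸ Set.subset_union_left))
    (hfin.subset (hunion ▸ Set.subset_union_right))
  rw [← hunion, ncard_monic_natDegree_two, ncard_split_quadratic] at h
  have h' : (Fintype.card F : ℚ) ^ 2 =
      ({b : F[X] | b.Monic ∧ Irreducible b ∧ b.natDegree = 2}.ncard : ℚ) +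
        ((Fintype.card F + 1).choose 2 : ℕ) := by exact_mod_cast h
  rw [Nat.cast_choose_two] at h'
  push_cast at h'
  linarith

end Counting

/-! ### Distinct words give distinct classes -/

section Distinct

variable {F : Type*} [Field F] [Fintype F]

theorem power_sub_smul_power (hq : 5 ≤ Fintype.card F) {a a' s : F}
    (h : powerWord (Fintype.card F - 3) a' - s • powerWord (Fintype.card F - 3) a ∈
      PRS F (Fintype.card F - 3)) : a = a' := by
  simp only [sub_mem_PRS_iff hq, map_smul, smul_eq_mul] at h
  have h2 := h 2 (by omega)
  have h3 := h 3 (by omega)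
  simp [syndrome_powerWord hq] at h2 h3
  rw [h3, ← h2, one_mul]

theorem pole_sub_smul_pole (hq : 5 ≤ Fintype.card F) {β β' a a' s : F}
    (h : poleWord β' a' - s • poleWord β a ∈ PRS F (Fintype.card F - 3)) : β = β' ∧ a = a' := by
  have hne : ∃ j < 4, syndrome j (poleWord β' a') ≠ 0 := by
    by_contra! h0
    exact not_mem_of_mem_poleWords hq (mem_poleWords.2 ⟨β', a', rfl⟩) ((mem_PRS_iff hq _).2 h0)
  simp only [sub_mem_PRS_iff hq, map_smul, smul_eq_mul] at h
  -- The apolar forms (X - β)² and (X - β')² coincide or share a root; both cases give β = β'.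
  have hβ : β = β' := by
    rcases ((apolar_poleWord hq β a).smul s h).eq_or_exists_root (apolar_poleWord hq β' a') hne
      with ⟨e0, e1⟩ | ⟨e, e0, e1⟩
    · have : (β - β') ^ 2 = 0 := by linear_combination -e0 - β * e1
      exact sub_eq_zero.1 (pow_eq_zero_iff two_ne_zero |>.1 this)
    · have h1 : (e - β) ^ 2 = 0 := by linear_combination e0
      have h2 : (e - β') ^ 2 = 0 := by linear_combination e1
      rw [← sub_eq_zero.1 (pow_eq_zero_iff two_ne_zero |>.1 h1),
        ← sub_eq_zero.1 (pow_eq_zero_iff two_ne_zero |>.1 h2)]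
  subst hβ
  have h0 := h 0 (by omega)
  have h1 := h 1 (by omega)
  simp [syndrome_poleWord hq] at h0 h1
  have hs : s = 1 := by
    rw [h0] at h1
    linear_combination h1
  exact ⟨rfl, by rw [h0, hs, one_mul]⟩

theorem quad_sub_smul_quad (hq : 5 ≤ Fintype.card F) {a a' b b' : F[X]} {s : F}
    (ha : a.Monic) (ha1 : a.natDegree ≤ 1) (hb : b.Monic) (hbi : Irreducible b)
    (hd : b.natDegree = 2) (ha' : a'.Monic) (ha1' : a'.natDegree ≤ 1) (hb' : b'.Monic)
    (hbi' : Irreducible b') (hd' : b'.natDegree = 2)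
    (h : fracWord a' b' - s • fracWord a b ∈ PRS F (Fintype.card F - 3)) : a = a' ∧ b = b' := by
  have hne : ∃ j < 4, syndrome j (fracWord a' b') ≠ 0 := by
    by_contra! h0
    exact ha'.ne_zero (eq_zero_of_fracWord_mem hq ha1' hbi' hd' ((mem_PRS_iff hq _).2 h0))
  have h' := h
  simp only [sub_mem_PRS_iff hq, map_smul, smul_eq_mul] at h'
  -- An irreducible quadratic has no root in the field, so the apolar forms coincide.
  have hbb : b = b' := by
    rcases ((apolar_fracWord hq ha1 hb hbi hd).smul s h').eq_or_exists_root
      (apolar_fracWord hq ha1' hb' hbi' hd') hne with ⟨e0, e1⟩ | ⟨e, e0, -⟩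
    · ext n
      rcases n with _ | _ | _ | n
      · exact e0
      · exact e1
      · have h2 : b.coeff 2 = 1 := hd ▸ hb.coeff_natDegree
        have h2' : b'.coeff 2 = 1 := hd' ▸ hb'.coeff_natDegree
        exact h2.trans h2'.symm
      · rw [coeff_eq_zero_of_natDegree_lt (by omega), coeff_eq_zero_of_natDegree_lt (by omega)]
    · exact absurd ((eval_eq_of_monic hb hd e).trans e0) (eval_ne_zero_of_irreducible hbi hd e)
  subst hbb
  rw [fracWord_sub_smul] at h
  have h0 := eq_zero_of_fracWord_mem hq ((natDegree_sub_le _ _).trans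
    (max_le ha1' ((natDegree_smul_le _ _).trans ha1))) hbi hd h
  have haa : a' = C s * a := by rw [← smul_eq_C_mul]; exact sub_eq_zero.1 h0
  have hs : s = 1 := by
    have := congr_arg leadingCoeff haa
    rw [leadingCoeff_mul, leadingCoeff_C, ha.leadingCoeff, ha'.leadingCoeff, mul_one] at this
    exact this.symm
  exact ⟨by rw [haa, hs, C_1, one_mul], rfl⟩

theorem pole_sub_smul_power_notMem (hq : 5 ≤ Fintype.card F) {u v : OnePoint F → F}
    (hu : u ∈ powerWords F (Fintype.card F - 3)) (hv : v ∈ poleWords F) (s : F) :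
    v - s • u ∉ PRS F (Fintype.card F - 3) := by
  obtain ⟨a, rfl⟩ := mem_powerWords.1 hu
  obtain ⟨β, a', rfl⟩ := mem_poleWords.1 hv
  intro h
  simp only [sub_mem_PRS_iff hq, map_smul, smul_eq_mul] at h
  have h0 := h 0 (by omega)
  have h1 := h 1 (by omega)
  simp [syndrome_poleWord hq, syndrome_powerWord hq] at h0 h1
  simp [h0] at h1

theorem quad_sub_smul_power_notMem (hq : 5 ≤ Fintype.card F) {u v : OnePoint F → F}
    (hu : u ∈ powerWords F (Fintype.card F - 3)) (hv : v ∈ quadWords F) (s : F) :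
    v - s • u ∉ PRS F (Fintype.card F - 3) := by
  have hvC := not_mem_of_mem_quadWords hq hv
  obtain ⟨a, rfl⟩ := mem_powerWords.1 hu
  obtain ⟨a', b, ha, ha1, hb, hbi, hd, rfl⟩ := mem_quadWords.1 hv
  intro h
  simp only [sub_mem_PRS_iff hq, map_smul, smul_eq_mul] at h
  have h0 := h 0 (by omega)
  have h1 := h 1 (by omega)
  simp [syndrome_powerWord hq] at h0 h1
  exact hvC ((mem_PRS_iff hq _).2 ((apolar_fracWord hq ha1 hb hbi hd).eq_zero h0 h1))

theorem quad_sub_smul_pole_notMem (hq : 5 ≤ Fintype.card F) {u v : OnePoint F → F}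
    (hu : u ∈ poleWords F) (hv : v ∈ quadWords F) (s : F) :
    v - s • u ∉ PRS F (Fintype.card F - 3) := by
  have hvC := not_mem_of_mem_quadWords hq hv
  obtain ⟨β, a, rfl⟩ := mem_poleWords.1 hu
  obtain ⟨a', b, ha, ha1, hb, hbi, hd, rfl⟩ := mem_quadWords.1 hv
  intro h
  simp only [sub_mem_PRS_iff hq, map_smul, smul_eq_mul] at h
  rw [mem_PRS_iff hq] at hvC
  push Not at hvC
  rcases (apolar_fracWord hq ha1 hb hbi hd).eq_or_exists_root
    ((apolar_poleWord hq β a).smul s h) hvC with ⟨e0, e1⟩ | ⟨e, e0, -⟩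
  · refine eval_ne_zero_of_irreducible hbi hd β ?_
    rw [eval_eq_of_monic hb hd, e0, e1]
    ring
  · exact eval_ne_zero_of_irreducible hbi hd e ((eval_eq_of_monic hb hd e).trans e0)

theorem eq_of_sub_smul_mem (hq : 5 ≤ Fintype.card F) {u v : OnePoint F → F}
    (hu : u ∈ powerWords F (Fintype.card F - 3) ∪ poleWords F ∪ quadWords F)
    (hv : v ∈ powerWords F (Fintype.card F - 3) ∪ poleWords F ∪ quadWords F) {s : F}
    (hs : s ≠ 0) (h : v - s • u ∈ PRS F (Fintype.card F - 3)) : u = v := by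
  have h' := sub_inv_smul_mem hs h
  rcases hu with (hu | hu) | hu <;> rcases hv with (hv | hv) | hv
  · obtain ⟨a, rfl⟩ := mem_powerWords.1 hu
    obtain ⟨a', rfl⟩ := mem_powerWords.1 hv
    rw [power_sub_smul_power hq h]
  · exact absurd h (pole_sub_smul_power_notMem hq hu hv s)
  · exact absurd h (quad_sub_smul_power_notMem hq hu hv s)
  · exact absurd h' (pole_sub_smul_power_notMem hq hv hu s⁻¹)
  · obtain ⟨β, a, rfl⟩ := mem_poleWords.1 hu
    obtain ⟨β', a', rfl⟩ := mem_poleWords.1 hv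
    obtain ⟨rfl, rfl⟩ := pole_sub_smul_pole hq h
    rfl
  · exact absurd h (quad_sub_smul_pole_notMem hq hu hv s)
  · exact absurd h' (quad_sub_smul_power_notMem hq hv hu s⁻¹)
  · exact absurd h' (quad_sub_smul_pole_notMem hq hv hu s⁻¹)
  · obtain ⟨a, b, ha, ha1, hb, hbi, hd, rfl⟩ := mem_quadWords.1 hu
    obtain ⟨a', b', ha', ha1', hb', hbi', hd', rfl⟩ := mem_quadWords.1 hv
    obtain ⟨rfl, rfl⟩ := quad_sub_smul_quad hq ha ha1 hb hbi hd ha' ha1' hb' hbi' hd' h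
    rfl

theorem ncard_powerWords (k : ℕ) : (powerWords F k).ncard = Fintype.card F := by
  have h : powerWords F k = powerWord k '' Set.univ := by
    ext u
    simp [mem_powerWords, eq_comm]
  rw [h, Set.ncard_image_of_injective, Set.ncard_univ, Nat.card_eq_fintype_card]
  exact fun a a' h => congr_fun h OnePoint.infty

theorem ncard_poleWords (hq : 5 ≤ Fintype.card F) :
    (poleWords F).ncard = Fintype.card F ^ 2 := by
  have h : poleWords F = (fun p : F × F => poleWord p.1 p.2) '' Set.univ := by
    ext u
    simp [mem_poleWords, eq_comm]
  rw [h, Set.ncard_image_of_injective, Set.ncard_univ, Nat.card_eq_fintype_card,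
    Fintype.card_prod, sq]
  intro p r h
  have := pole_sub_smul_pole hq (β := p.1) (β' := r.1) (a := p.2) (a' := r.2) (s := 1)
    (by rw [one_smul, ← show poleWord p.1 p.2 = poleWord r.1 r.2 from h, sub_self]
        exact Submodule.zero_mem _)
  exact Prod.ext this.1 this.2

theorem ncard_quadWords (hq : 5 ≤ Fintype.card F) :
    ((quadWords F).ncard : ℚ) =
      (Fintype.card F + 1) * Fintype.card F * (Fintype.card F - 1) / 2 := by
  have h : quadWords F = (fun p : F[X] × F[X] => fracWord p.1 p.2) ''
      ({a : F[X] | a.Monic ∧ a.natDegree ≤ 1} ×ˢ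
        {b : F[X] | b.Monic ∧ Irreducible b ∧ b.natDegree = 2}) := by
    ext u
    simp only [mem_quadWords, Set.mem_image, Set.mem_prod, Set.mem_ofPred_eq, Prod.exists]
    constructor
    · rintro ⟨a, b, ha, ha1, hb, hbi, hd, rfl⟩
      exact ⟨a, b, ⟨⟨ha, ha1⟩, hb, hbi, hd⟩, rfl⟩
    · rintro ⟨a, b, ⟨⟨ha, ha1⟩, hb, hbi, hd⟩, rfl⟩
      exact ⟨a, b, ha, ha1, hb, hbi, hd, rfl⟩
  rw [h, Set.InjOn.ncard_image, Set.ncard_prod, ncard_monic_natDegree_le_one]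
  · push_cast
    rw [ncard_irreducible_quadratic]
    ring
  · rintro ⟨a, b⟩ ⟨⟨ha, ha1⟩, hb, hbi, hd⟩ ⟨a', b'⟩ ⟨⟨ha', ha1'⟩, hb', hbi', hd'⟩ h
    have := quad_sub_smul_quad hq (s := 1) ha ha1 hb hbi hd ha' ha1' hb' hbi' hd'
      (by rw [one_smul, ← show fracWord a b = fracWord a' b' from h, sub_self]
          exact Submodule.zero_mem _)
    exact Prod.ext this.1 this.2

end Distinct

/-! ### Assembly of the main theorem -/

theorem mainTheorem3 (F : Type*) [Field F] [Fintype F] [DecidableEq F]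
    (q : ℕ) (hcard : Fintype.card F = q) (hq : 5 ≤ q) :
    -- the total number of deep hole classes
    ((deepHoleClasses (PRS F (q - 3))).ncard : ℚ) = q * (q + 1) ^ 2 / 2 ∧
    -- every word of the three families is a deep hole and not a codeword
    (∀ u ∈ powerWords F (q - 3) ∪ poleWords F ∪ quadWords F,
      IsDeepHole (PRS F (q - 3)) u ∧ u ∉ PRS F (q - 3)) ∧
    -- the three families give all the deep hole classes
    deepHoleClasses (PRS F (q - 3)) =
      classesOf (PRS F (q - 3)) (powerWords F (q - 3)) ∪ classesOf (PRS F (q - 3)) (poleWords F) ∪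
        classesOf (PRS F (q - 3)) (quadWords F) ∧
    -- the number of classes given by each family
    (classesOf (PRS F (q - 3)) (powerWords F (q - 3))).ncard = q ∧
    (classesOf (PRS F (q - 3)) (poleWords F)).ncard = q ^ 2 ∧
    ((classesOf (PRS F (q - 3)) (quadWords F)).ncard : ℚ) = (q + 1) * q * (q - 1) / 2 ∧
    -- distinct words of the three families represent distinct classes
    (∀ u ∈ powerWords F (q - 3) ∪ poleWords F ∪ quadWords F,
      ∀ v ∈ powerWords F (q - 3) ∪ poleWords F ∪ quadWords F,
      ∀ s : F, s ≠ 0 → v - s • u ∈ PRS F (q - 3) → u = v) ∧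
    -- the three families of classes are pairwise disjoint
    Disjoint (classesOf (PRS F (q - 3)) (powerWords F (q - 3)))
      (classesOf (PRS F (q - 3)) (poleWords F)) ∧
    Disjoint (classesOf (PRS F (q - 3)) (powerWords F (q - 3)))
      (classesOf (PRS F (q - 3)) (quadWords F)) ∧
    Disjoint (classesOf (PRS F (q - 3)) (poleWords F))
      (classesOf (PRS F (q - 3)) (quadWords F)) := by
  subst hcard
  have hmem : ∀ u ∈ powerWords F (Fintype.card F - 3) ∪ poleWords F ∪ quadWords F,
      u ∉ PRS F (Fintype.card F - 3) := by
    rintro u ((hu | hu) | hu)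
    · exact not_mem_of_mem_powerWords hq hu
    · exact not_mem_of_mem_poleWords hq hu
    · exact not_mem_of_mem_quadWords hq hu
  have hsub1 : powerWords F (Fintype.card F - 3) ⊆
      powerWords F (Fintype.card F - 3) ∪ poleWords F ∪ quadWords F :=
    fun u hu => Or.inl (Or.inl hu)
  have hsub2 : poleWords F ⊆ powerWords F (Fintype.card F - 3) ∪ poleWords F ∪ quadWords F :=
    fun u hu => Or.inl (Or.inr hu)
  have hsub3 : quadWords F ⊆ powerWords F (Fintype.card F - 3) ∪ poleWords F ∪ quadWords F :=
    fun u hu => Or.inr hu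
  have hncard : ∀ S ⊆ powerWords F (Fintype.card F - 3) ∪ poleWords F ∪ quadWords F,
      (classesOf (PRS F (Fintype.card F - 3)) S).ncard = S.ncard := fun S hS =>
    ncard_classesOf (fun u hu => hmem u (hS hu))
      fun u hu v hv s hs h => eq_of_sub_smul_mem hq (hS hu) (hS hv) hs h
  have hn1 : (classesOf (PRS F (Fintype.card F - 3)) (powerWords F (Fintype.card F - 3))).ncard =
      Fintype.card F := by rw [hncard _ hsub1, ncard_powerWords]
  have hn2 : (classesOf (PRS F (Fintype.card F - 3)) (poleWords F)).ncard =
      Fintype.card F ^ 2 := by rw [hncard _ hsub2, ncard_poleWords hq]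
  have hn3 : ((classesOf (PRS F (Fintype.card F - 3)) (quadWords F)).ncard : ℚ) =
      (Fintype.card F + 1) * Fintype.card F * (Fintype.card F - 1) / 2 := by
    rw [hncard _ hsub3, ncard_quadWords hq]
  have hd12 : Disjoint (classesOf (PRS F (Fintype.card F - 3)) (powerWords F (Fintype.card F - 3)))
      (classesOf (PRS F (Fintype.card F - 3)) (poleWords F)) :=
    disjoint_classesOf fun u hu v hv s _ => pole_sub_smul_power_notMem hq hu hv s
  have hd13 : Disjoint (classesOf (PRS F (Fintype.card F - 3)) (powerWords F (Fintype.card F - 3)))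
      (classesOf (PRS F (Fintype.card F - 3)) (quadWords F)) :=
    disjoint_classesOf fun u hu v hv s _ => quad_sub_smul_power_notMem hq hu hv s
  have hd23 : Disjoint (classesOf (PRS F (Fintype.card F - 3)) (poleWords F))
      (classesOf (PRS F (Fintype.card F - 3)) (quadWords F)) :=
    disjoint_classesOf fun u hu v hv s _ => quad_sub_smul_pole_notMem hq hu hv s
  have hall : deepHoleClasses (PRS F (Fintype.card F - 3)) =
      classesOf (PRS F (Fintype.card F - 3)) (powerWords F (Fintype.card F - 3)) ∪
        classesOf (PRS F (Fintype.card F - 3)) (poleWords F) ∪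
        classesOf (PRS F (Fintype.card F - 3)) (quadWords F) := by
    rw [← classesOf_union, ← classesOf_union]
    apply Set.Subset.antisymm
    · exact classesOf_subset fun u hu _ => exists_family_word hq ((isDeepHole_iff hq u).1 hu)
    · exact classesOf_mono fun u hu => (isDeepHole_iff hq u).2 (two_lt_errorDist hq hu)
  refine ⟨?_, fun u hu => ⟨(isDeepHole_iff hq u).2 (two_lt_errorDist hq hu), hmem u hu⟩, hall,
    hn1, hn2, hn3, fun u hu v hv s hs h => eq_of_sub_smul_mem hq hu hv hs h, hd12, hd13, hd23⟩
  -- Finiteness is needed for `Set.ncard` to be additive on disjoint unions.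
  have : Finite ((OnePoint F → F) ⧸ PRS F (Fintype.card F - 3)) :=
    Finite.of_surjective _ (Submodule.mkQ_surjective _)
  have hfin : ∀ S, (classesOf (PRS F (Fintype.card F - 3)) S).Finite := fun S => Set.toFinite _
  rw [hall, Set.ncard_union_eq (Set.disjoint_union_left.2 ⟨hd13, hd23⟩)
    ((hfin _).union (hfin _)) (hfin _), Set.ncard_union_eq hd12 (hfin _) (hfin _), hn1, hn2]
  push_cast
  rw [hn3]
  ring
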